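/- Let $G$ be a finitely generated group. For a subgroup $H\le G$, a subset $W\subseteq G$ is $H$-finite if it is contained in finitely many cosets $Hg$. A subset $X\subseteq G$ is $H$-almost invariant if $hX=X$ for all $h\in H$ and, for every $g\in G$, the images of $Xg$ and $X$ in $H\backslash G$ differ by finitely many elements; it is nontrivial if the images of $X$ and of its complement $X^*$ in $H\backslash G$ are both infinite. An $H$-almost invariant set $X$ and a $K$-almost invariant set $Y$ are equivalent if their symmetric difference is $H$-finite. $X$ is invertible if $gX=X^*$ for some $g\in G$. The $G$-orbits of $X$ and $X'$ are parallel if some translate $gX$ is equivalent to $X'$ or to $X'^*$. For a family $X_1,\dots,X_n$ of nontrivial almost invariant sets let $E(X_1,\dots,X_n)=\{gX_i,\,gX_i^*: g\in G,\ 1\le i\le n\}$. The corners of $U,V\in E$ are $U\cap V$, $U^*\cap V$, $U\cap V^*$, $U^*\cap V^*$; a corner is small if it is $H$-finite, where $U$ is almost invariant over $H$. The family is in good position if, whenever two of the corners of some $U,V\in E$ are small, one of their corners is empty. Then $U\le V$ means that $U\cap V^*$ is empty or is the only small corner of $U$ and $V$. An ultrafilter on $(E,\le)$ is a subset $V\subseteq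 E$ that contains exactly one of $A,A^*$ for each $A\in E$ and is closed upwards under $\le$. Let $\Lambda$ be the cubed complex whose vertices are these ultrafilters, with an edge joining two ultrafilters that differ by replacing a single element by its complement, and with one $d$-cube ($d\ge2$) attached for each occurrence of the boundary of a $d$-cube in the $(d-1)$-skeleton. Let $L(X_1,\dots,X_n)$ be the $G$-invariant component of $\Lambda$ containing the ultrafilters that agree, except on a finite subset of $E$, with $\{A\in E: g\in A\}$ for some $g\in G$. **Lemma.** Let $H_1,\dots,H_n$ be finitely generated subgroups of $G$, and for each $i$ let $X_i$ be a nontrivial $H_i$-almost invariant subset of $G$. Suppose that for distinct $i,j$ the $G$-orbits of $X_i$ and $X_j$ are not parallel. Suppose that each $X_i$ is equivalent to almost invariant sets $Y_i$ and $Z_i$, that the family $(Y_i)$ is in good position, that the family $(Z_i)$ is in good position, and that no $Y_i$ and no $Z_i$ is invertible. Then there is a $G$-equivariant bijection $\varphi:E(Y_1,\dots,Y_n)\to E(Z_1,\dots,Z_n)$ that preserves complementation, is an isomorphism for the partial orders $\le$ (that is, $U\le V$ if and only if $\varphi(U)\le\varphi(V)$), and preserves equivalence classes (that is, $\varphi(U)$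 is equivalent to $U$ for every $U$). Moreover $V\mapsto\varphi(V)$ defines a $G$-equivariant isomorphism of cubed complexes $L(Y_1,\dots,Y_n)\to L(Z_1,\dots,Z_n)$. Hence the cubing $L$ depends only on the equivalence classes of the $X_i$. -/

import Mathlib

open scoped Pointwise

namespace AlmostInvariant

variable {G : Type*} [Group G]

/-- The projection `G → H\G` onto the set of cosets `Hg`, i.e. the quotient of `G` by the left
action of `H`. -/
def proj (H : Subgroup G) (x : G) : Quotient (QuotientGroup.rightRel H) :=
  Quotient.mk (QuotientGroup.rightRel H) x

/-- Two sets are almost equal if their symmetric difference is finite. -/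
def AlmostEqual {α : Type*} (P Q : Set α) : Prop :=
  (symmDiff P Q).Finite

/-- `X` is almost invariant over `H`: it is invariant under the left action of `H`, and `H\X` is an
almost invariant subset of `H\G` for the right action of `G`. The translate `(H\X)g` is the
projection of `Xg`. -/
def IsAlmostInvariant (H : Subgroup G) (X : Set G) : Prop :=
  (∀ h ∈ H, h • X = X) ∧
    ∀ g : G, AlmostEqual (proj H '' (MulOpposite.op g • X)) (proj H '' X)

/-- `X` is a nontrivial `H`-almost invariant set: moreover `H\X` and `H\X*` are both infinite. -/
def IsNontrivialAlmostInvariant (H : Subgroup G) (X : Set G) : Prop :=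
  IsAlmostInvariant H X ∧ (proj H '' X).Infinite ∧ (proj H '' Xᶜ).Infinite

/-- `W` is contained in the union of finitely many cosets `Hg`. -/
def IsFiniteOver (H : Subgroup G) (W : Set G) : Prop :=
  ∃ F : Set G, F.Finite ∧ W ⊆ (H : Set G) * F

/-- The symmetric difference of `V` and `W` is `H`-finite. -/
def AlmostEqualOver (H : Subgroup G) (V W : Set G) : Prop :=
  IsFiniteOver H (symmDiff V W)

/-- Equivalence of almost invariant sets: `X` is `H`-almost invariant, `Y` is `K`-almost
invariant, and they are `H`-almost equal. -/
def Equivalent (X Y : Set G) : Prop :=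
  ∃ H K : Subgroup G, IsAlmostInvariant H X ∧ IsAlmostInvariant K Y ∧ AlmostEqualOver H X Y

/-- The intersection of `U` and `V` is small: it is `H`-finite, where `U` is nontrivial and almost
invariant over `H`. -/
def IsSmallInter (U V : Set G) : Prop :=
  ∃ H : Subgroup G, IsNontrivialAlmostInvariant H U ∧ IsFiniteOver H (U ∩ V)

/-- `X` is invertible if some translate of it is its complement. -/
def IsInvertible (X : Set G) : Prop :=
  ∃ g : G, g • X = Xᶜ

/-- The `G`-orbits of `X` and `Y` are parallel if some translate of `X` is equivalent to `Y` or to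
the complement of `Y`. -/
def OrbitsParallel (X Y : Set G) : Prop :=
  ∃ g : G, Equivalent (g • X) Y ∨ Equivalent (g • X) Yᶜ

/-- `U` or its complement, according to a sign. -/
def signed (U : Set G) : Bool → Set G
  | true => U
  | false => Uᶜ

/-- Almost inclusion: `U ∩ V*` is empty, or it is the only small one among the four corners of `U`
and `V`. -/
def AlmostLE (U V : Set G) : Prop :=
  U ∩ Vᶜ = ∅ ∨
    (IsSmallInter U Vᶜ ∧ ¬ IsSmallInter U V ∧ ¬ IsSmallInter Uᶜ V ∧ ¬ IsSmallInter Uᶜ Vᶜ)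

section Family

variable {ι : Type*}

/-- The set `E(X)` of all translates of the sets `X i` and of their complements. -/
def translates (X : ι → Set G) : Set (Set G) :=
  {A | ∃ (g : G) (i : ι), A = g • X i ∨ A = g • (X i)ᶜ}

/-- Good position: if two of the four corners of two elements of `E(X)` are small, then one of
their corners is empty. -/
def GoodPosition (X : ι → Set G) : Prop :=
  ∀ U ∈ translates X, ∀ V ∈ translates X, ∀ a b a' b' : Bool, (a, b) ≠ (a', b') →
    IsSmallInter (signed U a) (signed V b) → IsSmallInter (signed U a') (signed V b') →
      ∃ c d : Bool, signed U c ∩ signed V d = ∅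

theorem smul_mem_translates (X : ι → Set G) (g : G) {A : Set G} (hA : A ∈ translates X) :
    g • A ∈ translates X := by
  obtain ⟨k, i, rfl | rfl⟩ := hA
  · exact ⟨g * k, i, Or.inl (smul_smul _ _ _)⟩
  · exact ⟨g * k, i, Or.inr (smul_smul _ _ _)⟩

theorem compl_mem_translates (X : ι → Set G) {A : Set G} (hA : A ∈ translates X) :
    Aᶜ ∈ translates X := by
  obtain ⟨k, i, rfl | rfl⟩ := hA
  · exact ⟨k, i, Or.inr (Set.smul_set_compl).symm⟩
  · exact ⟨k, i, Or.inl (by rw [Set.smul_set_compl, compl_compl])⟩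

/-- The left action of `G` on `E(X)`. -/
instance translatesAction (X : ι → Set G) : MulAction G (translates X) where
  smul g A := ⟨g • A.1, smul_mem_translates X g A.2⟩
  one_smul A := Subtype.ext (one_smul G A.1)
  mul_smul g h A := Subtype.ext (mul_smul g h A.1)

/-- The involution `A ↦ A*` of `E(X)`. -/
def star {X : ι → Set G} (A : translates X) : translates X :=
  ⟨A.1ᶜ, compl_mem_translates X A.2⟩

/-- The ultrafilters on `E(X)` with respect to almost inclusion. -/
@[ext]
structure UltrafilterOn (X : ι → Set G) where
  /-- the underlying subset of `E(X)` -/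
  carrier : Set (translates X)
  mem_or : ∀ A, A ∈ carrier ∨ star A ∈ carrier
  not_both : ∀ A, ¬ (A ∈ carrier ∧ star A ∈ carrier)
  upward : ∀ A ∈ carrier, ∀ B : translates X, AlmostLE A.1 B.1 → B ∈ carrier

end Family

/-! Invariance of almost inclusion under translation, needed for the action on ultrafilters. -/

theorem proj_eq_iff (H : Subgroup G) (x y : G) : proj H x = proj H y ↔ y * x⁻¹ ∈ H := by
  unfold proj
  rw [Quotient.eq]
  exact QuotientGroup.rightRel_apply

/-- The conjugate subgroup `gHg⁻¹`. -/
def conj (g : G) (H : Subgroup G) : Subgroup G := H.map (MulAut.conj g).toMonoidHom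

theorem mem_conj (g : G) (H : Subgroup G) (x : G) : x ∈ conj g H ↔ g⁻¹ * x * g ∈ H := by
  unfold conj
  rw [Subgroup.mem_map]
  constructor
  · rintro ⟨y, hy, rfl⟩
    simpa [mul_assoc] using hy
  · intro h
    exact ⟨_, h, by simp [mul_assoc]⟩

theorem exists_transport (g : G) (H : Subgroup G) :
    ∃ e : Quotient (QuotientGroup.rightRel H) → Quotient (QuotientGroup.rightRel (conj g H)),
      Function.Injective e ∧ ∀ S : Set G, proj (conj g H) '' (g • S) = e '' (proj H '' S) := by
  have key : ∀ x y : G, proj H x = proj H y ↔ proj (conj g H) (g * x) = proj (conj g H) (g * y) := by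
    intro x y
    rw [proj_eq_iff, proj_eq_iff, mem_conj]
    simp [mul_assoc]
  refine ⟨Quotient.lift (fun x => proj (conj g H) (g * x)) ?_, ?_, ?_⟩
  · intro x y h
    exact (key x y).1 (Quotient.sound h)
  · intro p q
    induction p using Quotient.inductionOn with
    | h x =>
      induction q using Quotient.inductionOn with
      | h y => exact fun h => (key x y).2 h
  · intro S
    ext q
    constructor
    · rintro ⟨_, ⟨x, hx, rfl⟩, rfl⟩
      exact ⟨proj H x, ⟨x, hx, rfl⟩, rfl⟩
    · rintro ⟨_, ⟨x, hx, rfl⟩, rfl⟩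
      exact ⟨g • x, ⟨x, hx, rfl⟩, rfl⟩

theorem IsAlmostInvariant.smul {H : Subgroup G} {X : Set G} (h : IsAlmostInvariant H X) (g : G) :
    IsAlmostInvariant (conj g H) (g • X) := by
  obtain ⟨e, he, hS⟩ := exists_transport g H
  refine ⟨fun k hk => ?_, fun a => ?_⟩
  · have := h.1 _ ((mem_conj g H k).1 hk)
    calc k • g • X = g • ((g⁻¹ * k * g) • X) := by simp [smul_smul, mul_assoc]
      _ = g • X := by rw [this]
  · have h2 := h.2 a
    unfold AlmostEqual at h2 ⊢
    rw [smul_comm, hS, hS, ← Set.image_symmDiff he]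
    exact h2.image e

theorem IsNontrivialAlmostInvariant.smul {H : Subgroup G} {X : Set G}
    (h : IsNontrivialAlmostInvariant H X) (g : G) :
    IsNontrivialAlmostInvariant (conj g H) (g • X) := by
  obtain ⟨e, he, hS⟩ := exists_transport g H
  refine ⟨h.1.smul g, ?_, ?_⟩
  · rw [hS]
    exact h.2.1.image he.injOn
  · rw [← Set.smul_set_compl, hS]
    exact h.2.2.image he.injOn

theorem IsSmallInter.smul {U V : Set G} (h : IsSmallInter U V) (g : G) :
    IsSmallInter (g • U) (g • V) := by
  obtain ⟨H, hU, F, hF, hs⟩ := h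
  refine ⟨conj g H, hU.smul g, g • F, hF.smul_set, ?_⟩
  rw [← Set.smul_set_inter]
  rintro _ ⟨x, hx, rfl⟩
  obtain ⟨k, hk, f, hf, rfl⟩ := Set.mem_mul.1 (hs hx)
  refine Set.mem_mul.2 ⟨g * k * g⁻¹, (mem_conj g H _).2 ?_, g * f, ⟨f, hf, rfl⟩, ?_⟩
  · simpa [mul_assoc] using hk
  · simp [mul_assoc]

theorem isSmallInter_smul_iff (g : G) (U V : Set G) :
    IsSmallInter (g • U) (g • V) ↔ IsSmallInter U V :=
  ⟨fun h => by simpa using h.smul g⁻¹, fun h => h.smul g⟩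

theorem almostLE_smul_iff (g : G) (U V : Set G) : AlmostLE (g • U) (g • V) ↔ AlmostLE U V := by
  unfold AlmostLE
  simp only [← Set.smul_set_compl, ← Set.smul_set_inter, isSmallInter_smul_iff,
    Set.smul_set_eq_empty]

section Cubing

variable {ι : Type*} {X : ι → Set G}

theorem star_smul (g : G) (A : translates X) : star (g • A) = g • star A :=
  Subtype.ext (Set.smul_set_compl).symm

theorem star_star (A : translates X) : star (star A) = A :=
  Subtype.ext (compl_compl A.1)

/-- The action of `G` on the ultrafilters induced by its action on `E(X)`. -/
instance ultrafilterAction (X : ι → Set G) : MulAction G (UltrafilterOn X) where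
  smul g V :=
    { carrier := g • V.carrier
      mem_or := fun A => by
        simp only [Set.mem_smul_set_iff_inv_smul_mem, ← star_smul]
        exact V.mem_or _
      not_both := fun A => by
        simp only [Set.mem_smul_set_iff_inv_smul_mem, ← star_smul]
        exact V.not_both _
      upward := fun A hA B hAB => by
        rw [Set.mem_smul_set_iff_inv_smul_mem] at hA ⊢
        exact V.upward _ hA _ ((almostLE_smul_iff g⁻¹ A.1 B.1).2 hAB) }
  one_smul V := UltrafilterOn.ext (one_smul G V.carrier)
  mul_smul g h V := UltrafilterOn.ext (mul_smul g h V.carrier)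

theorem carrier_smul (g : G) (V : UltrafilterOn X) : (g • V).carrier = g • V.carrier := rfl

/-- The 1-skeleton of the cubed complex `Λ`: its vertices are the ultrafilters, and two of them
are joined by an edge if they differ by replacing a single element by its complement. -/
def skeleton (X : ι → Set G) : SimpleGraph (UltrafilterOn X) where
  Adj V W := ∃ A ∈ V.carrier, W.carrier = (V.carrier \ {A}) ∪ {star A}
  symm := ⟨by
    rintro V W ⟨A, hA, hW⟩
    have hsA : star A ∉ V.carrier := fun h => V.not_both A ⟨hA, h⟩
    refine ⟨star A, by simp [hW], ?_⟩
    rw [hW, star_star]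
    ext B
    simp only [Set.mem_union, Set.mem_sdiff, Set.mem_singleton_iff]
    constructor
    · intro hB
      by_cases h : B = A
      · exact Or.inr h
      · exact Or.inl ⟨Or.inl ⟨hB, h⟩, fun h' => hsA (h' ▸ hB)⟩
    · rintro (⟨h | h, h'⟩ | h)
      · exact h.1
      · exact absurd h h'
      · exact h ▸ hA⟩
  loopless := ⟨by
    rintro V ⟨A, hA, hV⟩
    have hs : star A ∈ V.carrier := by
      rw [hV]
      simp
    exact V.not_both A ⟨hA, hs⟩⟩

/-- An ultrafilter agreeing, except on a finite subset of `E(X)`, with the set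
`{A ∈ E(X) | g ∈ A}` for some `g` in `G`. -/
def IsBasic (W : UltrafilterOn X) : Prop :=
  ∃ g : G, AlmostEqual W.carrier {A | g ∈ A.1}

/-- The vertices of `L(X)`, the component of the cubed complex `Λ` that contains the basic
vertices. -/
def LVertex (X : ι → Set G) : Type _ :=
  {V : UltrafilterOn X // ∃ W, IsBasic W ∧ (skeleton X).Reachable W V}

theorem skeleton_adj_smul (g : G) {V W : UltrafilterOn X} (h : (skeleton X).Adj V W) :
    (skeleton X).Adj (g • V) (g • W) := by
  obtain ⟨A, hA, hW⟩ := h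
  refine ⟨g • A, Set.smul_mem_smul_set hA, ?_⟩
  rw [carrier_smul, carrier_smul, hW, Set.smul_set_union, Set.smul_set_sdiff,
    Set.smul_set_singleton, Set.smul_set_singleton, star_smul]

theorem IsBasic.smul {W : UltrafilterOn X} (h : IsBasic W) (g : G) : IsBasic (g • W) := by
  obtain ⟨k, hk⟩ := h
  refine ⟨g * k, ?_⟩
  have : {A : translates X | g * k ∈ A.1} = g • {A : translates X | k ∈ A.1} := by
    ext A
    rw [Set.mem_smul_set_iff_inv_smul_mem]
    change g * k ∈ A.1 ↔ k ∈ g⁻¹ • A.1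
    rw [Set.mem_smul_set_iff_inv_smul_mem, inv_inv, smul_eq_mul]
  unfold AlmostEqual at hk ⊢
  rw [this, carrier_smul, ← Set.smul_set_symmDiff]
  exact hk.smul_set

/-- The action of `G` on the vertices of `L(X)`. -/
instance lVertexAction (X : ι → Set G) : MulAction G (LVertex X) where
  smul g V := ⟨g • V.1, by
    obtain ⟨W, hW, hr⟩ := V.2
    let f : skeleton X →g skeleton X := ⟨fun U => g • U, fun h => skeleton_adj_smul g h⟩
    exact ⟨g • W, hW.smul g, hr.map f⟩⟩
  one_smul V := Subtype.ext (one_smul G V.1)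
  mul_smul g h V := Subtype.ext (mul_smul g h V.1)

/-- The cubes of `L(X)`. In dimensions at least two, exactly one cube is glued in for each
occurrence of the boundary of a cube in the skeleton one dimension lower. So a `d`-cube is given by
its set of vertices, and the sets that occur are the images of the injective maps from the vertices
of the standard `d`-cube that send edges to edges. -/
def IsCube (X : ι → Set G) (d : ℕ) (S : Set (LVertex X)) : Prop :=
  ∃ f : (Fin d → Bool) → LVertex X, Function.Injective f ∧ Set.range f = S ∧
    ∀ a b, hammingDist a b = 1 → (skeleton X).Adj (f a).1 (f b).1

end Cubing

end AlmostInvariant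

/-!
Inclusion of non-equivalent elements of `E(Y)` is decided by which of their corners are small, hence
by equivalence classes alone. Equivalent elements are nested, by good position, and only the
direction of the inclusion may depend on the representatives. When `g • U` is equivalent to `U`,
it does not: if `g • U ⊆ U` but `V ⊆ g • V`, then `g` maps `U \ V` into itself and `g⁻¹` maps
`V \ U` into itself. Both are finite over the stabilizer of `V`, so unless `U = V` a power of `g`
fixes `V`, and then so does `g`.

There remain the inclusions between `U` and its equivalent reflections `r • Uᶜ`. Replacing `U` by a
translate or its complement, choose it innermost among the sets contained in their reflection under
one such `r`. Every other reflection then is compared with `U` by an element `g` with `g • U`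
equivalent to `U`, as no translate lies strictly between `U` and `r • Uᶜ`. Choosing `V` innermost in
the same way, `U ↦ V` extends to an order isomorphism. It moves an element of `G` across only
finitely many members of `E(Y)`, so it maps basic ultrafilters to basic ultrafilters.
-/

namespace AlmostInvariant

variable {G : Type*} [Group G]

open MulAction (stabilizer)
open MulOpposite (op)

section FiniteOver

variable {H K : Subgroup G} {V W : Set G}

theorem isFiniteOver_iff : IsFiniteOver H W ↔ (proj H '' W).Finite := by
  constructor
  · rintro ⟨F, hF, hW⟩
    refine (hF.image (proj H)).subset ?_
    rintro _ ⟨w, hw, rfl⟩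
    obtain ⟨h, hh, f, hf, rfl⟩ := hW hw
    exact ⟨f, hf, (proj_eq_iff H _ _).2 (by simpa using hh)⟩
  · intro hfin
    refine ⟨Quotient.out '' (proj H '' W), hfin.image _, fun w hw => ?_⟩
    have hw' : w * (proj H w).out⁻¹ ∈ H := (proj_eq_iff H _ _).1 (Quotient.out_eq (proj H w))
    exact ⟨_, hw', _, Set.mem_image_of_mem _ (Set.mem_image_of_mem _ hw), by simp⟩

theorem IsFiniteOver.mono (hW : IsFiniteOver H W) (hVW : V ⊆ W) : IsFiniteOver H V :=
  hW.imp fun _ hF => ⟨hF.1, hVW.trans hF.2⟩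

theorem isFiniteOver_empty : IsFiniteOver H ∅ :=
  ⟨∅, Set.finite_empty, Set.empty_subset _⟩

theorem IsFiniteOver.union (hV : IsFiniteOver H V) (hW : IsFiniteOver H W) :
    IsFiniteOver H (V ∪ W) := by
  rw [isFiniteOver_iff, Set.image_union]
  exact (isFiniteOver_iff.1 hV).union (isFiniteOver_iff.1 hW)

theorem IsFiniteOver.biUnion {α : Type*} {s : Set α} {W : α → Set G} (hs : s.Finite)
    (hW : ∀ a ∈ s, IsFiniteOver H (W a)) : IsFiniteOver H (⋃ a ∈ s, W a) := by
  rw [isFiniteOver_iff, Set.image_iUnion₂]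
  exact hs.biUnion fun a ha => isFiniteOver_iff.1 (hW a ha)

theorem IsFiniteOver.trans (hW : IsFiniteOver H W) (hHK : IsFiniteOver K (H : Set G)) :
    IsFiniteOver K W := by
  obtain ⟨F, hF, hWF⟩ := hW
  obtain ⟨F', hF', hH⟩ := hHK
  refine ⟨F' * F, hF'.mul hF, hWF.trans ?_⟩
  rw [← mul_assoc]
  exact Set.mul_subset_mul_right hH

theorem IsFiniteOver.smul (hW : IsFiniteOver H W) (g : G) : IsFiniteOver (conj g H) (g • W) := by
  obtain ⟨e, -, he⟩ := exists_transport g H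
  rw [isFiniteOver_iff, he]
  exact (isFiniteOver_iff.1 hW).image e

theorem IsFiniteOver.op_smul (hW : IsFiniteOver H W) (t : G) : IsFiniteOver H (op t • W) := by
  obtain ⟨F, hF, hWF⟩ := hW
  refine ⟨op t • F, hF.smul_set, ?_⟩
  rw [mul_smul_comm]
  exact Set.smul_set_mono hWF

theorem IsFiniteOver.of_forall_mul_mem (hW : IsFiniteOver H W) (x : G)
    (hx : ∀ k ∈ K, k * x ∈ W) : IsFiniteOver H (K : Set G) :=
  (hW.op_smul x⁻¹).mono fun k hk => ⟨k * x, hx k hk, by simp⟩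

theorem IsFiniteOver.exists_pow_mem (hW : IsFiniteOver H W) {g x : G}
    (hx : ∀ n : ℕ, g ^ n * x ∈ W) : ∃ p : ℕ, 0 < p ∧ g ^ p ∈ H := by
  obtain ⟨m, n, hmn, heq⟩ := Set.Finite.exists_lt_map_eq_of_forall_mem
    (fun n => Set.mem_image_of_mem (proj H) (hx n)) (isFiniteOver_iff.1 hW)
  refine ⟨n - m, Nat.sub_pos_of_lt hmn, ?_⟩
  rw [pow_sub g hmn.le]
  simpa [mul_assoc] using (proj_eq_iff H _ _).1 heq

theorem mul_mem_coe_mul_iff {h : G} (hh : h ∈ H) {x : G} :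
    h * x ∈ (H : Set G) * W ↔ x ∈ (H : Set G) * W := by
  have hHW : h • ((H : Set G) * W) = H * W := by rw [← smul_mul_assoc, smul_coe_set hh]
  exact MulAction.mem_stabilizer_set.1 (MulAction.mem_stabilizer_iff.2 hHW) x

end FiniteOver

section AlmostInvariance

variable {H K : Subgroup G} {U V W : Set G}

theorem IsAlmostInvariant.le_stabilizer (hU : IsAlmostInvariant H U) : H ≤ stabilizer G U :=
  hU.1

theorem mul_mem_iff_of_le_stabilizer (hU : H ≤ stabilizer G U) {h : G} (hh : h ∈ H) (x : G) :
    h * x ∈ U ↔ x ∈ U :=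
  MulAction.mem_stabilizer_set.1 (hU hh) x

theorem preimage_image_proj (hU : H ≤ stabilizer G U) : proj H ⁻¹' (proj H '' U) = U := by
  refine Set.Subset.antisymm ?_ (Set.subset_preimage_image _ _)
  rintro x ⟨y, hy, hyx⟩
  simpa using (mul_mem_iff_of_le_stabilizer hU ((proj_eq_iff H y x).1 hyx) y).2 hy

theorem image_proj_symmDiff (hU : H ≤ stabilizer G U) (hV : H ≤ stabilizer G V) :
    proj H '' symmDiff U V = symmDiff (proj H '' U) (proj H '' V) := by
  have hproj : Function.Surjective (proj H) := Quotient.mk_surjective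
  have hUV : H ≤ stabilizer G (symmDiff U V) := fun h hh => by
    rw [MulAction.mem_stabilizer_iff, Set.smul_set_symmDiff, hU hh, hV hh]
  apply hproj.preimage_injective
  rw [Set.preimage_symmDiff, preimage_image_proj hU, preimage_image_proj hV,
    preimage_image_proj hUV]

theorem isAlmostInvariant_iff :
    IsAlmostInvariant H U ↔ H ≤ stabilizer G U ∧ ∀ t : G, AlmostEqualOver H (op t • U) U := by
  refine and_congr_right fun hU => forall_congr' fun t => ?_
  have htU : H ≤ stabilizer G (op t • U) := fun h hh => by
    rw [MulAction.mem_stabilizer_iff, smul_comm, hU h hh]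
  rw [AlmostEqualOver, isFiniteOver_iff, image_proj_symmDiff htU hU, AlmostEqual]

theorem IsAlmostInvariant.almostEqualOver_op_smul (hU : IsAlmostInvariant H U) (t : G) :
    AlmostEqualOver H (op t • U) U :=
  (isAlmostInvariant_iff.1 hU).2 t

theorem IsAlmostInvariant.isFiniteOver_boundary (hU : IsAlmostInvariant H U) (t : G) :
    IsFiniteOver H {x ∈ U | x * t ∉ U} :=
  (hU.almostEqualOver_op_smul t⁻¹).mono fun x hx =>
    Or.inr ⟨hx.1, fun hxt => hx.2 (by simpa [Set.mem_smul_set_iff_inv_smul_mem] using hxt)⟩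

theorem IsAlmostInvariant.compl (hU : IsAlmostInvariant H U) : IsAlmostInvariant H Uᶜ := by
  refine isAlmostInvariant_iff.2 ⟨fun h hh => ?_, fun t => ?_⟩
  · rw [MulAction.mem_stabilizer_iff, Set.smul_set_compl, hU.1 h hh]
  · rw [AlmostEqualOver, Set.smul_set_compl, compl_symmDiff_compl]
    exact hU.almostEqualOver_op_smul t

theorem isNontrivialAlmostInvariant_iff :
    IsNontrivialAlmostInvariant H U ↔
      IsAlmostInvariant H U ∧ ¬ IsFiniteOver H U ∧ ¬ IsFiniteOver H Uᶜ := by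
  rw [isFiniteOver_iff, isFiniteOver_iff]
  rfl

theorem IsNontrivialAlmostInvariant.compl (hU : IsNontrivialAlmostInvariant H U) :
    IsNontrivialAlmostInvariant H Uᶜ :=
  ⟨hU.1.compl, hU.2.2, by rw [compl_compl]; exact hU.2.1⟩

theorem IsNontrivialAlmostInvariant.not_isFiniteOver (hU : IsNontrivialAlmostInvariant H U) :
    ¬ IsFiniteOver H U :=
  (isNontrivialAlmostInvariant_iff.1 hU).2.1

theorem IsNontrivialAlmostInvariant.exists_notMem (hU : IsNontrivialAlmostInvariant H U)
    (hW : IsFiniteOver H W) : ∃ x ∈ U, x ∉ W := by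
  by_contra! hUW
  exact hU.not_isFiniteOver (hW.mono hUW)

theorem almostEqualOver_refl : AlmostEqualOver H U U := by
  rw [AlmostEqualOver, symmDiff_self]
  exact isFiniteOver_empty

theorem AlmostEqualOver.symm (h : AlmostEqualOver H U V) : AlmostEqualOver H V U := by
  rwa [AlmostEqualOver, symmDiff_comm]

theorem AlmostEqualOver.trans (hUV : AlmostEqualOver H U V) (hVW : AlmostEqualOver H V W) :
    AlmostEqualOver H U W :=
  (IsFiniteOver.union hUV hVW).mono (symmDiff_triangle U V W)

theorem AlmostEqualOver.compl (h : AlmostEqualOver H U V) : AlmostEqualOver H Uᶜ Vᶜ := by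
  rwa [AlmostEqualOver, compl_symmDiff_compl]

theorem AlmostEqualOver.smul (h : AlmostEqualOver H U V) (g : G) :
    AlmostEqualOver (conj g H) (g • U) (g • V) := by
  rw [AlmostEqualOver, ← Set.smul_set_symmDiff]
  exact IsFiniteOver.smul h g

theorem AlmostEqualOver.isFiniteOver_iff (h : AlmostEqualOver H U V) :
    IsFiniteOver H U ↔ IsFiniteOver H V := by
  suffices key : ∀ {U V : Set G}, AlmostEqualOver H U V → IsFiniteOver H V → IsFiniteOver H U from
    ⟨key h.symm, key h⟩
  intro U V h hV
  refine (hV.union h).mono fun x hx => ?_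
  by_cases hxV : x ∈ V
  exacts [Or.inl hxV, Or.inr (Or.inl ⟨hx, hxV⟩)]

theorem AlmostEqualOver.inter_right (h : AlmostEqualOver H U V) (W : Set G) :
    AlmostEqualOver H (U ∩ W) (V ∩ W) :=
  IsFiniteOver.mono h <| by
    rw [← Set.inter_symmDiff_distrib_right]
    exact Set.inter_subset_left

theorem IsNontrivialAlmostInvariant.isFiniteOver_of_almostEqualOver
    (hU : IsNontrivialAlmostInvariant H U) (hV : K ≤ stabilizer G V)
    (h : AlmostEqualOver H U V) : IsFiniteOver H (K : Set G) := by
  obtain ⟨x, hxU, hx⟩ := hU.exists_notMem h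
  obtain ⟨y, hyU, hy⟩ := hU.compl.exists_notMem h
  have hxV : x ∈ V := by_contra fun hxV => hx (Or.inl ⟨hxU, hxV⟩)
  have hyV : y ∉ V := fun hyV => hy (Or.inr ⟨hyV, hyU⟩)
  have hfin := ((hU.1.isFiniteOver_boundary (x⁻¹ * y)).union h).union
    (IsFiniteOver.op_smul h (x⁻¹ * y)⁻¹)
  -- As `k * x ∈ V` and `k * y ∉ V`, one of the two points lies in the symmetric difference of `U`
  -- and `V`, unless `U` separates them too.
  refine hfin.of_forall_mul_mem x fun k hk => ?_
  have hkx : k * x ∈ V := (mul_mem_iff_of_le_stabilizer hV hk x).2 hxV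
  have hky : k * y ∉ V := fun hky => hyV ((mul_mem_iff_of_le_stabilizer hV hk y).1 hky)
  by_cases hkxU : k * x ∈ U
  · by_cases hkyU : k * y ∈ U
    · exact Or.inr ⟨k * y, Or.inl ⟨hkyU, hky⟩, by simp [mul_assoc]⟩
    · exact Or.inl (Or.inl ⟨hkxU, by simpa [mul_assoc] using hkyU⟩)
  · exact Or.inl (Or.inr (Or.inr ⟨hkx, hkxU⟩))

theorem IsNontrivialAlmostInvariant.isFiniteOver_inter_right
    (hU : IsNontrivialAlmostInvariant H U) (hV : IsAlmostInvariant K V)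
    (h : IsFiniteOver H (U ∩ V)) : IsFiniteOver K (U ∩ V) := by
  obtain ⟨F, hF, hUV⟩ := h
  obtain ⟨x, hxU, hx⟩ := hU.exists_notMem ⟨F, hF, subset_rfl⟩
  refine (IsFiniteOver.biUnion hF fun f _ => hV.isFiniteOver_boundary (f⁻¹ * x)).mono ?_
  intro w hw
  obtain ⟨k, hk, f, hf, rfl⟩ := hUV hw
  refine Set.mem_biUnion hf ⟨hw.2, fun hkx => hx ((mul_mem_coe_mul_iff hk).1 (hUV ?_))⟩
  replace hkx : k * x ∈ V := by simpa [mul_assoc] using hkx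
  exact ⟨(mul_mem_iff_of_le_stabilizer hU.1.le_stabilizer hk x).2 hxU, hkx⟩

theorem IsNontrivialAlmostInvariant.almostEqualOver_right
    (hU : IsNontrivialAlmostInvariant H U) (hV : IsAlmostInvariant K V)
    (h : AlmostEqualOver H U V) : AlmostEqualOver K U V := by
  have hUV : IsFiniteOver H (U ∩ Vᶜ) := IsFiniteOver.mono h Set.subset_union_left
  have hVU : IsFiniteOver H (Uᶜ ∩ V) :=
    IsFiniteOver.mono h fun x hx => Or.inr ⟨hx.2, hx.1⟩
  refine ((hU.isFiniteOver_inter_right hV.compl hUV).union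
    (hU.compl.isFiniteOver_inter_right hV hVU)).mono ?_
  rintro x (hx | hx)
  exacts [Or.inl hx, Or.inr ⟨hx.2, hx.1⟩]

theorem IsNontrivialAlmostInvariant.of_almostEqualOver (hU : IsNontrivialAlmostInvariant H U)
    (hV : IsAlmostInvariant K V) (h : AlmostEqualOver H U V) :
    IsNontrivialAlmostInvariant K V := by
  have hK := hU.isFiniteOver_of_almostEqualOver hV.le_stabilizer h
  refine isNontrivialAlmostInvariant_iff.2 ⟨hV, fun hfin => ?_, fun hfin => ?_⟩
  · exact hU.not_isFiniteOver (h.isFiniteOver_iff.2 (hfin.trans hK))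
  · exact hU.compl.not_isFiniteOver (h.compl.isFiniteOver_iff.2 (hfin.trans hK))

theorem IsNontrivialAlmostInvariant.isFiniteOver_congr (hU : IsNontrivialAlmostInvariant H U)
    (hV : IsAlmostInvariant K V) (h : AlmostEqualOver H U V) :
    IsFiniteOver H W ↔ IsFiniteOver K W := by
  have hV' := hU.of_almostEqualOver hV h
  have h' := (hU.almostEqualOver_right hV h).symm
  exact ⟨fun hW => hW.trans (hV'.isFiniteOver_of_almostEqualOver hU.1.le_stabilizer h'),
    fun hW => hW.trans (hU.isFiniteOver_of_almostEqualOver hV.le_stabilizer h)⟩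

end AlmostInvariance

/-- `U` is a nontrivial almost invariant set over some subgroup. -/
def IsNontrivial (U : Set G) : Prop :=
  ∃ H : Subgroup G, IsNontrivialAlmostInvariant H U

/-- Equivalence of nontrivial almost invariant sets. Unlike `Equivalent`, it is symmetric and
transitive. -/
def NontrivialEquivalent (U V : Set G) : Prop :=
  ∃ H K : Subgroup G, IsNontrivialAlmostInvariant H U ∧ IsNontrivialAlmostInvariant K V ∧
    AlmostEqualOver H U V

local notation:50 U:51 " ∼ " V:51 => NontrivialEquivalent U V

section Equivalence

variable {H : Subgroup G} {A B U U' V V' W : Set G}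

theorem IsNontrivial.compl (hU : IsNontrivial U) : IsNontrivial Uᶜ :=
  hU.imp fun _ h => h.compl

theorem IsNontrivial.smul (hU : IsNontrivial U) (g : G) : IsNontrivial (g • U) :=
  hU.elim fun H h => ⟨conj g H, h.smul g⟩

theorem IsNontrivial.nonempty (hU : IsNontrivial U) : U.Nonempty := by
  obtain ⟨H, hH⟩ := hU
  obtain ⟨x, hx, -⟩ := hH.exists_notMem isFiniteOver_empty
  exact ⟨x, hx⟩

theorem IsNontrivial.refl (hU : IsNontrivial U) : U ∼ U :=
  hU.elim fun H h => ⟨H, H, h, h, almostEqualOver_refl⟩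

theorem IsNontrivialAlmostInvariant.nontrivialEquivalent (hU : IsNontrivialAlmostInvariant H U)
    (h : Equivalent U V) : U ∼ V := by
  obtain ⟨K, L, hK, hL, hUV⟩ := h
  have hUV' : AlmostEqualOver H U V := (hU.isFiniteOver_congr hK almostEqualOver_refl).2 hUV
  exact ⟨H, L, hU, hU.of_almostEqualOver hL hUV', hUV'⟩

namespace NontrivialEquivalent

theorem left (h : U ∼ V) : IsNontrivial U :=
  let ⟨H, _, hU, _⟩ := h
  ⟨H, hU⟩

theorem equivalent (h : U ∼ V) : Equivalent U V :=
  let ⟨H, K, hU, hV, hUV⟩ := h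
  ⟨H, K, hU.1, hV.1, hUV⟩

theorem symm (h : U ∼ V) : V ∼ U :=
  let ⟨H, K, hU, hV, hUV⟩ := h
  ⟨K, H, hV, hU, (hU.almostEqualOver_right hV.1 hUV).symm⟩

theorem right (h : U ∼ V) : IsNontrivial V :=
  h.symm.left

theorem almostEqualOver (h : U ∼ V) (hU : IsNontrivialAlmostInvariant H U) :
    AlmostEqualOver H U V :=
  let ⟨_, _, hU', _, hUV⟩ := h
  (hU'.isFiniteOver_congr hU.1 almostEqualOver_refl).1 hUV

theorem trans (hUV : U ∼ V) (hVW : V ∼ W) : U ∼ W := by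
  obtain ⟨H, K, hU, hV, h⟩ := hUV
  obtain ⟨L, hW⟩ := hVW.right
  have hVW' : AlmostEqualOver H V W :=
    (hU.isFiniteOver_congr hV.1 h).2 (hVW.almostEqualOver hV)
  exact ⟨H, L, hU, hW, h.trans hVW'⟩

theorem compl (h : U ∼ V) : Uᶜ ∼ Vᶜ :=
  let ⟨H, K, hU, hV, hUV⟩ := h
  ⟨H, K, hU.compl, hV.compl, hUV.compl⟩

theorem smul (h : U ∼ V) (g : G) : g • U ∼ g • V :=
  let ⟨H, K, hU, hV, hUV⟩ := h
  ⟨conj g H, conj g K, hU.smul g, hV.smul g, hUV.smul g⟩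

end NontrivialEquivalent

theorem isSmallInter_iff (hU : IsNontrivialAlmostInvariant H U) :
    IsSmallInter U V ↔ IsFiniteOver H (U ∩ V) :=
  ⟨fun ⟨_, hK, h⟩ => (hK.isFiniteOver_congr hU.1 almostEqualOver_refl).1 h, fun h => ⟨H, hU, h⟩⟩

theorem IsSmallInter.symm (h : IsSmallInter U V) (hV : IsNontrivial V) : IsSmallInter V U := by
  obtain ⟨H, hU, hUV⟩ := h
  obtain ⟨K, hK⟩ := hV
  refine ⟨K, hK, ?_⟩
  rw [Set.inter_comm]
  exact hU.isFiniteOver_inter_right hK.1 hUV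

theorem IsSmallInter.mono (h : IsSmallInter U V) (hWV : W ⊆ V) : IsSmallInter U W :=
  h.imp fun _ hU => ⟨hU.1, hU.2.mono (Set.inter_subset_inter_right U hWV)⟩

theorem IsNontrivial.isSmallInter_of_inter_eq_empty (hU : IsNontrivial U) (h : U ∩ V = ∅) :
    IsSmallInter U V :=
  hU.imp fun _ hH => ⟨hH, h ▸ isFiniteOver_empty⟩

theorem isSmallInter_congr_left (h : U ∼ U') : IsSmallInter U V ↔ IsSmallInter U' V := by
  obtain ⟨H, K, hU, hU', hUU'⟩ := h
  rw [isSmallInter_iff hU, isSmallInter_iff hU', ← hU.isFiniteOver_congr hU'.1 hUU']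
  exact (hUU'.inter_right V).isFiniteOver_iff

theorem isSmallInter_comm (hU : IsNontrivial U) (hV : IsNontrivial V) :
    IsSmallInter U V ↔ IsSmallInter V U :=
  ⟨fun h => h.symm hV, fun h => h.symm hU⟩

theorem isSmallInter_congr (hU : U ∼ U') (hV : V ∼ V') :
    IsSmallInter U V ↔ IsSmallInter U' V' := by
  rw [isSmallInter_congr_left hU, isSmallInter_comm hU.right hV.left, isSmallInter_congr_left hV,
    isSmallInter_comm hV.right hU.right]

theorem IsSmallInter.not_compl_right (h : IsSmallInter U V) : ¬ IsSmallInter U Vᶜ := by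
  obtain ⟨H, hU, hUV⟩ := h
  rw [isSmallInter_iff hU]
  intro hUVc
  exact hU.not_isFiniteOver (Set.inter_union_compl U V ▸ hUV.union hUVc)

theorem IsSmallInter.not_compl_left (h : IsSmallInter U V) (hV : IsNontrivial V) :
    ¬ IsSmallInter Uᶜ V :=
  fun hUcV => (h.symm hV).not_compl_right (hUcV.symm hV)

theorem nontrivialEquivalent_iff (hU : IsNontrivial U) (hV : IsNontrivial V) :
    U ∼ V ↔ IsSmallInter U Vᶜ ∧ IsSmallInter Uᶜ V := by
  obtain ⟨H, hH⟩ := hU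
  obtain ⟨K, hK⟩ := hV
  have hsymmDiff : symmDiff U V = U ∩ Vᶜ ∪ Uᶜ ∩ V := by
    rw [Set.symmDiff_def, Set.sdiff_eq, Set.sdiff_eq, Set.inter_comm V]
  rw [isSmallInter_iff hH, isSmallInter_iff hH.compl]
  constructor
  · intro h
    have hfin : IsFiniteOver H (symmDiff U V) := h.almostEqualOver hH
    rw [hsymmDiff] at hfin
    exact ⟨hfin.mono Set.subset_union_left, hfin.mono Set.subset_union_right⟩
  · rintro ⟨hUV, hVU⟩
    exact ⟨H, K, hH, hK, by rw [AlmostEqualOver, hsymmDiff]; exact hUV.union hVU⟩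

theorem NontrivialEquivalent.of_subset_of_subset (h : U ∼ W) (hV : IsNontrivial V) (hUV : U ⊆ V)
    (hVW : V ⊆ W) : U ∼ V := by
  refine (nontrivialEquivalent_iff h.left hV).2 ⟨?_, ?_⟩
  · exact h.left.isSmallInter_of_inter_eq_empty (Set.sdiff_eq_empty.2 hUV)
  · exact ((nontrivialEquivalent_iff h.left h.right).1 h).2.mono hVW

theorem NontrivialEquivalent.almostLE_iff_subset (h : U ∼ V) : AlmostLE U V ↔ U ⊆ V := by
  have hUV := ((nontrivialEquivalent_iff h.left h.right).1 h).2
  rw [AlmostLE, ← Set.sdiff_eq, Set.sdiff_eq_empty]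
  exact or_iff_left fun hsmall => hsmall.2.2.1 hUV

theorem almostLE_iff_isSmallInter (hU : IsNontrivial U) (hV : IsNontrivial V) (h : ¬ U ∼ V) :
    AlmostLE U V ↔ IsSmallInter U Vᶜ := by
  constructor
  · rintro (hUV | hUV)
    exacts [hU.isSmallInter_of_inter_eq_empty hUV, hUV.1]
  · intro hUV
    refine Or.inr ⟨hUV, fun hsmall => hsmall.not_compl_right hUV, fun hsmall => ?_,
      hUV.not_compl_left hV.compl⟩
    exact h ((nontrivialEquivalent_iff hU hV).2 ⟨hUV, hsmall⟩)

theorem almostLE_congr (hAB : A ∼ B) (hUV : U ∼ V) (h : A ∼ U → (A ⊆ U ↔ B ⊆ V)) :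
    AlmostLE A U ↔ AlmostLE B V := by
  have hequiv : A ∼ U ↔ B ∼ V :=
    ⟨fun hAU => (hAB.symm.trans hAU).trans hUV, fun hBV => (hAB.trans hBV).trans hUV.symm⟩
  by_cases hAU : A ∼ U
  · rw [hAU.almostLE_iff_subset, (hequiv.1 hAU).almostLE_iff_subset, h hAU]
  · rw [almostLE_iff_isSmallInter hAB.left hUV.left hAU,
      almostLE_iff_isSmallInter hAB.right hUV.right (mt hequiv.2 hAU)]
    exact isSmallInter_congr hAB hUV.compl

end Equivalence

/-- The set `E(U)` of the translates of a single set `U` and of its complement. -/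
def signedOrbit (U : Set G) : Set (Set G) :=
  translates fun _ : Unit => U

/-- Any two equivalent elements of `E(U)` are comparable under inclusion. -/
def HasNestedOrbit (U : Set G) : Prop :=
  ∀ A ∈ signedOrbit U, ∀ B ∈ signedOrbit U, A ∼ B → A ⊆ B ∨ B ⊆ A

section SignedOrbit

variable {ι : Type*} {X : ι → Set G} {H : Subgroup G} {A B U U' V V' W : Set G} {g : G}

theorem mem_signedOrbit_iff : A ∈ signedOrbit U ↔ ∃ g : G, A = g • U ∨ A = g • Uᶜ := by
  simp [signedOrbit, translates]

theorem self_mem_signedOrbit : U ∈ signedOrbit U :=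
  mem_signedOrbit_iff.2 ⟨1, Or.inl (one_smul G U).symm⟩

theorem smul_mem_signedOrbit (g : G) (hA : A ∈ signedOrbit U) : g • A ∈ signedOrbit U :=
  smul_mem_translates _ g hA

theorem compl_mem_signedOrbit (hA : A ∈ signedOrbit U) : Aᶜ ∈ signedOrbit U :=
  compl_mem_translates _ hA

theorem mem_signedOrbit_symm (hA : A ∈ signedOrbit U) : U ∈ signedOrbit A := by
  obtain ⟨g, rfl | rfl⟩ := mem_signedOrbit_iff.1 hA
  · exact mem_signedOrbit_iff.2 ⟨g⁻¹, Or.inl (inv_smul_smul g U).symm⟩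
  · exact mem_signedOrbit_iff.2 ⟨g⁻¹, Or.inr (by simp [← Set.smul_set_compl])⟩

theorem signedOrbit_subset_of_mem (hA : A ∈ signedOrbit U) : signedOrbit A ⊆ signedOrbit U := by
  intro B hB
  obtain ⟨g, rfl | rfl⟩ := mem_signedOrbit_iff.1 hB
  exacts [smul_mem_signedOrbit g hA, smul_mem_signedOrbit g (compl_mem_signedOrbit hA)]

theorem signedOrbit_eq_of_mem (hA : A ∈ signedOrbit U) : signedOrbit A = signedOrbit U :=
  (signedOrbit_subset_of_mem hA).antisymm (signedOrbit_subset_of_mem (mem_signedOrbit_symm hA))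

theorem translates_eq_iUnion : translates X = ⋃ i, signedOrbit (X i) := by
  ext A
  simp only [translates, Set.mem_iUnion, mem_signedOrbit_iff, Set.mem_ofPred_eq]
  exact exists_comm

theorem IsNontrivial.of_mem_signedOrbit (hU : IsNontrivial U) (hA : A ∈ signedOrbit U) :
    IsNontrivial A := by
  obtain ⟨g, rfl | rfl⟩ := mem_signedOrbit_iff.1 hA
  exacts [hU.smul g, hU.compl.smul g]

theorem IsInvertible.of_mem_signedOrbit (h : IsInvertible A) (hA : A ∈ signedOrbit U) :
    IsInvertible U := by
  obtain ⟨k, hk⟩ := h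
  obtain ⟨g, hg⟩ := mem_signedOrbit_iff.1 hA
  have hkg : k • g • U = (g • U)ᶜ := by
    rcases hg with rfl | rfl
    · exact hk
    · rwa [Set.smul_set_compl, Set.smul_set_compl, compl_inj_iff] at hk
  exact ⟨g⁻¹ * k * g, by rw [mul_smul, mul_smul, hkg, ← Set.smul_set_compl, inv_smul_smul]⟩

theorem HasNestedOrbit.of_mem_signedOrbit (h : HasNestedOrbit U) (hA : A ∈ signedOrbit U) :
    HasNestedOrbit A := by
  rwa [HasNestedOrbit, signedOrbit_eq_of_mem hA]

theorem GoodPosition.hasNestedOrbit (h : GoodPosition X) (i : ι) : HasNestedOrbit (X i) := by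
  intro A hA B hB hAB
  have hmem : signedOrbit (X i) ⊆ translates X := by
    rw [translates_eq_iUnion]
    exact Set.subset_iUnion (fun i => signedOrbit (X i)) i
  obtain ⟨hABc, hAcB⟩ := (nontrivialEquivalent_iff hAB.left hAB.right).1 hAB
  obtain ⟨c, d, hcd⟩ :=
    h A (hmem hA) B (hmem hB) true false false true (by decide) hABc hAcB
  match c, d, hcd with
  | true, true, hcd =>
    exact absurd hABc (hAB.left.isSmallInter_of_inter_eq_empty hcd).not_compl_right
  | true, false, hcd => exact Or.inl (Set.sdiff_eq_empty.1 hcd)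
  | false, true, hcd =>
    rw [Set.inter_comm] at hcd
    exact Or.inr (Set.sdiff_eq_empty.1 hcd)
  | false, false, hcd =>
    exact absurd (hAB.left.compl.isSmallInter_of_inter_eq_empty hcd) hAcB.not_compl_right

theorem exists_mem_signedOrbit_nontrivialEquivalent (h : U ∼ V) (hA : A ∈ signedOrbit U) :
    ∃ B ∈ signedOrbit V, A ∼ B := by
  obtain ⟨g, rfl | rfl⟩ := mem_signedOrbit_iff.1 hA
  · exact ⟨g • V, smul_mem_signedOrbit g self_mem_signedOrbit, h.smul g⟩
  · exact ⟨g • Vᶜ, smul_mem_signedOrbit g (compl_mem_signedOrbit self_mem_signedOrbit),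
      h.compl.smul g⟩

theorem orbitsParallel_of_mem_signedOrbit (hA : A ∈ signedOrbit U) (hB : B ∈ signedOrbit V)
    (hAB : A ∼ B) : OrbitsParallel U V := by
  have hUA := mem_signedOrbit_symm hA
  obtain ⟨C, hC, hUC⟩ := exists_mem_signedOrbit_nontrivialEquivalent hAB hUA
  rw [signedOrbit_eq_of_mem hB] at hC
  obtain ⟨g, rfl | rfl⟩ := mem_signedOrbit_iff.1 hC
  · exact ⟨g⁻¹, Or.inl (by simpa using (hUC.smul g⁻¹).equivalent)⟩
  · exact ⟨g⁻¹, Or.inr (by simpa using (hUC.smul g⁻¹).equivalent)⟩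

theorem finite_smul_of_isFiniteOver (hU : H ≤ stabilizer G U) (hW : IsFiniteOver H W) (x : G) :
    {A | ∃ g : G, A = g • U ∧ g⁻¹ * x ∈ W}.Finite := by
  obtain ⟨F, hF, hWF⟩ := hW
  refine (hF.image fun f => (x * f⁻¹) • U).subset ?_
  rintro _ ⟨g, rfl, hg⟩
  obtain ⟨h, hh, f, hf, hhf⟩ := hWF hg
  have hgh : x * f⁻¹ = g * h := by
    rw [mul_inv_eq_iff_eq_mul, mul_assoc, ← inv_mul_eq_iff_eq_mul]
    exact hhf.symm
  refine ⟨f, hf, ?_⟩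
  change (x * f⁻¹) • U = g • U
  rw [hgh, mul_smul, hU hh]

theorem finite_separating (hU : IsNontrivial U) (x y : G) :
    {A ∈ signedOrbit U | x ∈ A ∧ y ∉ A}.Finite := by
  obtain ⟨H, hH⟩ := hU
  have hfin : ∀ {V : Set G}, IsAlmostInvariant H V →
      {A | ∃ g : G, A = g • V ∧ g⁻¹ * x ∈ {w ∈ V | w * (x⁻¹ * y) ∉ V}}.Finite := fun hV =>
    finite_smul_of_isFiniteOver hV.le_stabilizer (hV.isFiniteOver_boundary (x⁻¹ * y)) x
  refine ((hfin hH.1).union (hfin hH.1.compl)).subset ?_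
  rintro A ⟨hA, hx, hy⟩
  obtain ⟨g, rfl | rfl⟩ := mem_signedOrbit_iff.1 hA
  all_goals
    rw [Set.mem_smul_set_iff_inv_smul_mem, smul_eq_mul] at hx hy
  · exact Or.inl ⟨g, rfl, hx, by simpa [mul_assoc] using hy⟩
  · exact Or.inr ⟨g, rfl, hx, by simpa [mul_assoc] using hy⟩

end SignedOrbit

section Contraction

variable {K : Subgroup G} {U V W : Set G} {g : G}

theorem antitone_pow_smul (hU : g • U ⊆ U) : Antitone fun n : ℕ => g ^ n • U := by
  simpa only [smul_iterate] using
    Monotone.antitone_iterate_of_map_le (f := fun A : Set G => g • A)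
      (fun _ _ h => Set.smul_set_mono h) hU

theorem smul_eq_of_smul_subset_of_isFiniteOver (hK : K ≤ stabilizer G V) (hV : g • V ⊆ V)
    (hW : IsFiniteOver K W) (hgW : g • W ⊆ W) (hne : W.Nonempty) : g • V = V := by
  -- All `g ^ n * x` lie in the finitely many cosets that cover `W`, so two of them share a coset.
  obtain ⟨x, hx⟩ := hne
  obtain ⟨p, hp, hgp⟩ := hW.exists_pow_mem (g := g) (x := x) fun n => by
    simpa using antitone_pow_smul hgW (Nat.zero_le n) (Set.smul_mem_smul_set hx)
  refine hV.antisymm ?_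
  calc V = g ^ p • V := (hK hgp).symm
    _ ⊆ g ^ 1 • V := antitone_pow_smul hV hp
    _ = g • V := by rw [pow_one]

theorem NontrivialEquivalent.smul_eq_of_smul_subset_of_subset_smul (h : U ∼ V)
    (hU : g • U ⊆ U) (hV : V ⊆ g • V) : g • V = V := by
  obtain ⟨K, hK⟩ := h.right
  have hfin : IsFiniteOver K (symmDiff U V) := (h.symm.almostEqualOver hK).symm
  have hUc : g⁻¹ • Uᶜ ⊆ Uᶜ := by
    rwa [← Set.subset_smul_set_iff, Set.smul_set_compl, Set.compl_subset_compl]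
  have hV' : g⁻¹ • V ⊆ V := Set.subset_smul_set_iff.1 hV
  have hVc : g • Vᶜ ⊆ Vᶜ := by rwa [Set.smul_set_compl, Set.compl_subset_compl]
  rcases (U \ V).eq_empty_or_nonempty with hUV | hUV
  · rcases (V \ U).eq_empty_or_nonempty with hVU | hVU
    · obtain rfl : U = V := (Set.sdiff_eq_empty.1 hUV).antisymm (Set.sdiff_eq_empty.1 hVU)
      exact hU.antisymm hV
    · have hgVU : g⁻¹ • (V \ U) ⊆ V \ U := by
        rw [Set.sdiff_eq, Set.smul_set_inter]
        exact Set.inter_subset_inter hV' hUc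
      rw [← eq_inv_smul_iff, eq_comm]
      exact smul_eq_of_smul_subset_of_isFiniteOver hK.1.le_stabilizer hV'
        (hfin.mono Set.subset_union_right) hgVU hVU
  · have hgUV : g • (U \ V) ⊆ U \ V := by
      rw [Set.sdiff_eq, Set.smul_set_inter]
      exact Set.inter_subset_inter hU hVc
    have hgVc : g • Vᶜ = Vᶜ := smul_eq_of_smul_subset_of_isFiniteOver hK.compl.1.le_stabilizer hVc
      (hfin.mono Set.subset_union_left) hgUV hUV
    rwa [Set.smul_set_compl, compl_inj_iff] at hgVc

theorem NontrivialEquivalent.smul_subset_iff (h : U ∼ V) (hU : HasNestedOrbit U)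
    (hV : HasNestedOrbit V) (hgU : g • U ∼ U) : g • U ⊆ U ↔ g • V ⊆ V := by
  suffices key : ∀ {U V : Set G}, U ∼ V → HasNestedOrbit V → g • U ∼ U →
      g • U ⊆ U → g • V ⊆ V from
    ⟨key h hV hgU, key h.symm hU (((h.symm.smul g).trans hgU).trans h)⟩
  intro U V h hV hgU hsub
  have hgV : g • V ∼ V := ((h.symm.smul g).trans hgU).trans h
  rcases hV _ (smul_mem_signedOrbit g self_mem_signedOrbit) _ self_mem_signedOrbit hgV
    with hle | hge
  exacts [hle, (h.smul_eq_of_smul_subset_of_subset_smul hsub hge).subset]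

end Contraction

/-- `A` is an innermost element of `E(A)` contained in its reflection `r • Aᶜ`: nothing in `E(A)`
lies strictly between the two. -/
def IsCentral (r : G) (A : Set G) : Prop :=
  A ⊆ r • Aᶜ ∧ ∀ B ∈ signedOrbit A, A ⊆ B → B ⊆ r • Aᶜ → B = A ∨ B = r • Aᶜ

section Reflection

variable {A B U V : Set G} {g r : G}

theorem smul_compl_subset_smul_compl_iff : r • Aᶜ ⊆ r • Bᶜ ↔ B ⊆ A := by
  rw [Set.smul_set_subset_smul_set_iff, Set.compl_subset_compl]

theorem smul_compl_mem_signedOrbit (r : G) (hA : A ∈ signedOrbit U) : r • Aᶜ ∈ signedOrbit U :=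
  smul_mem_signedOrbit r (compl_mem_signedOrbit hA)

theorem NontrivialEquivalent.reflect (h : U ∼ V) (hr : U ∼ r • Uᶜ) : V ∼ r • Vᶜ :=
  (h.symm.trans hr).trans (h.compl.smul r)

theorem HasNestedOrbit.smul_smul_eq (hA : HasNestedOrbit A) (hr : A ∼ r • Aᶜ) :
    r • r • A = A := by
  have hrr : (r * r) • A ∼ A := by
    simpa [mul_smul, Set.smul_set_compl] using (hr.trans (hr.compl.smul r)).symm
  -- `r * r` contracts `A` iff it contracts the equivalent set `r • Aᶜ`, but reflecting reverses
  -- inclusions.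
  have hswap : (r * r) • A ⊆ A ↔ A ⊆ (r * r) • A := by
    rw [hr.smul_subset_iff hA
      (hA.of_mem_signedOrbit (smul_compl_mem_signedOrbit r self_mem_signedOrbit)) hrr,
      ← smul_compl_subset_smul_compl_iff (r := r) (A := (r * r) • A)]
    simp only [mul_smul, Set.smul_set_compl]
  rw [← mul_smul]
  rcases hA _ (smul_mem_signedOrbit (r * r) self_mem_signedOrbit) _ self_mem_signedOrbit hrr
    with h | h
  exacts [h.antisymm (hswap.1 h), (hswap.2 h).antisymm h]

theorem HasNestedOrbit.reflect_reflect (hA : HasNestedOrbit A) (hr : A ∼ r • Aᶜ) :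
    r • (r • Aᶜ)ᶜ = A := by
  rw [← Set.smul_set_compl, compl_compl, hA.smul_smul_eq hr]

theorem HasNestedOrbit.exists_subset_reflect (hU : HasNestedOrbit U) (hr : U ∼ r • Uᶜ) :
    ∃ A ∈ signedOrbit U, U ∼ A ∧ A ⊆ r • Aᶜ := by
  have hmem := smul_compl_mem_signedOrbit r (self_mem_signedOrbit (U := U))
  rcases hU _ self_mem_signedOrbit _ hmem hr with h | h
  · exact ⟨U, self_mem_signedOrbit, hr.left.refl, h⟩
  · exact ⟨r • Uᶜ, hmem, hr, by rwa [hU.reflect_reflect hr]⟩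

theorem HasNestedOrbit.exists_isCentral (hU : HasNestedOrbit U) (hr : U ∼ r • Uᶜ) :
    ∃ A ∈ signedOrbit U, U ∼ A ∧ IsCentral r A := by
  obtain ⟨A₀, hA₀, hUA₀, hA₀r⟩ := hU.exists_subset_reflect hr
  let S : Set (Set G) := {A ∈ signedOrbit U | U ∼ A ∧ A ⊆ r • Aᶜ ∧ A₀ ⊆ A}
  have hS : S.Finite := by
    obtain ⟨x, hx⟩ := hUA₀.right.nonempty
    obtain ⟨y, hy⟩ := (hUA₀.reflect hr).right.compl.nonempty
    refine (finite_separating hr.left x y).subset ?_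
    rintro A ⟨hA, -, hAr, hA₀A⟩
    exact ⟨hA, hA₀A hx, fun hyA => hy (smul_compl_subset_smul_compl_iff.2 hA₀A (hAr hyA))⟩
  obtain ⟨A, ⟨hA, hUA, hAr, hA₀A⟩, hmax⟩ :=
    hS.exists_maximal ⟨A₀, hA₀, hUA₀, hA₀r, subset_rfl⟩
  refine ⟨A, hA, hUA, hAr, fun B hB hAB hBr => ?_⟩
  rw [signedOrbit_eq_of_mem hA] at hB
  have hUB : U ∼ B := hUA.trans <|
    (hUA.reflect hr).of_subset_of_subset (hr.left.of_mem_signedOrbit hB) hAB hBr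
  have hBB : B ∼ r • Bᶜ := hUB.reflect hr
  have hArBr := (hU.of_mem_signedOrbit hA).reflect_reflect (hUA.reflect hr)
  have hrB := smul_compl_mem_signedOrbit r hB
  rcases hU B hB _ hrB hBB with h | h
  · exact Or.inl ((hmax ⟨hB, hUB, h, hA₀A.trans hAB⟩ hAB).antisymm hAB)
  · have hBrr := (hU.of_mem_signedOrbit hB).reflect_reflect hBB
    have hABr : A ⊆ r • Bᶜ := by
      rw [← hArBr]
      exact smul_compl_subset_smul_compl_iff.2 hBr
    have hBrA : r • Bᶜ = A :=
      (hmax ⟨hrB, hUB.trans hBB, by rwa [hBrr], hA₀A.trans hABr⟩ hABr).antisymm hABr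
    exact Or.inr (by rw [← hBrA, hBrr])

theorem IsCentral.smul_subset_reflect_iff (hA : IsCentral r A) (hinv : ¬ IsInvertible A)
    (hnest : g • A ⊆ A ∨ A ⊆ g • A) : g • A ⊆ r • Aᶜ ↔ g • A ⊆ A := by
  refine ⟨fun h => hnest.elim id fun hAg => ?_, fun h => h.trans hA.1⟩
  rcases hA.2 _ (smul_mem_signedOrbit g self_mem_signedOrbit) hAg h with heq | heq
  · exact heq.subset
  · exact absurd ⟨r⁻¹ * g, by rw [mul_smul, heq, inv_smul_smul]⟩ hinv

theorem smul_subset_compl_iff_subset_reflect (r : G) :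
    g • A ⊆ Aᶜ ↔ (r * g⁻¹) • A ⊆ r • Aᶜ := by
  rw [mul_smul, Set.smul_set_subset_smul_set_iff, ← Set.subset_smul_set_iff, Set.smul_set_compl,
    Set.subset_compl_comm]

theorem IsCentral.smul_subset_compl_iff (hA : IsCentral r A) (hB : IsCentral r B) (hAB : A ∼ B)
    (hr : A ∼ r • Aᶜ) (hAnest : HasNestedOrbit A) (hBnest : HasNestedOrbit B)
    (hAinv : ¬ IsInvertible A) (hBinv : ¬ IsInvertible B) (hg : g • A ∼ Aᶜ) :
    g • A ⊆ Aᶜ ↔ g • B ⊆ Bᶜ := by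
  have hA' : (r * g⁻¹) • A ∼ A := by
    have hrg : (r * g⁻¹) • A ∼ r • Aᶜ := by
      simpa [mul_smul, Set.smul_set_compl] using (hg.symm.smul g⁻¹).compl.smul r
    exact hrg.trans hr.symm
  have hB' : (r * g⁻¹) • B ∼ B := ((hAB.symm.smul _).trans hA').trans hAB
  rw [smul_subset_compl_iff_subset_reflect r, smul_subset_compl_iff_subset_reflect r,
    hA.smul_subset_reflect_iff hAinv
      (hAnest _ (smul_mem_signedOrbit _ self_mem_signedOrbit) _ self_mem_signedOrbit hA'),
    hB.smul_subset_reflect_iff hBinv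
      (hBnest _ (smul_mem_signedOrbit _ self_mem_signedOrbit) _ self_mem_signedOrbit hB'),
    hAB.smul_subset_iff hAnest hBnest hA']

end Reflection

/-- The pairs of elements of `E(U)` and `E(V)` that correspond to each other when `U` is sent
to `V`. -/
def Corresponding (U V A B : Set G) : Prop :=
  ∃ g : G, (A = g • U ∧ B = g • V) ∨ (A = g • Uᶜ ∧ B = g • Vᶜ)

/-- `R` is the graph of a correspondence between the families `𝒜` and `ℬ` of nontrivial almost
invariant sets that respects translation, complementation, equivalence classes, and inclusions
between equivalent sets. -/
structure IsOrderCorrespondence (R : Set G → Set G → Prop) (𝒜 ℬ : Set (Set G)) : Prop where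
  mem_left : ∀ {A B}, R A B → A ∈ 𝒜
  mem_right : ∀ {A B}, R A B → B ∈ ℬ
  exists_right : ∀ {A}, A ∈ 𝒜 → ∃ B, R A B
  exists_left : ∀ {B}, B ∈ ℬ → ∃ A, R A B
  smul : ∀ {A B} (g : G), R A B → R (g • A) (g • B)
  compl : ∀ {A B}, R A B → R Aᶜ Bᶜ
  nontrivialEquivalent : ∀ {A B}, R A B → A ∼ B
  subset_iff : ∀ {A B C D}, R A B → R C D → A ∼ C → (A ⊆ C ↔ B ⊆ D)

section Correspondence

variable {A B C D U V : Set G} {g k : G}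

theorem smul_subset_smul_iff : g • A ⊆ k • B ↔ (k⁻¹ * g) • A ⊆ B := by
  rw [mul_smul, Set.subset_smul_set_iff]

theorem NontrivialEquivalent.inv_mul_smul (h : g • A ∼ k • B) : (k⁻¹ * g) • A ∼ B := by
  simpa only [mul_smul, inv_smul_smul] using h.smul k⁻¹

theorem compl_subset_smul_iff_not (hU : HasNestedOrbit U) (hinv : ¬ IsInvertible U)
    (hg : g • U ∼ Uᶜ) : Uᶜ ⊆ g • U ↔ ¬ g • U ⊆ Uᶜ := by
  refine ⟨fun h h' => hinv ⟨g, h'.antisymm h⟩, fun h => ?_⟩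
  exact (hU _ (smul_mem_signedOrbit g self_mem_signedOrbit) _
    (compl_mem_signedOrbit self_mem_signedOrbit) hg).resolve_left h

theorem Corresponding.subset_iff (hUV : U ∼ V) (hU : HasNestedOrbit U) (hV : HasNestedOrbit V)
    (hUinv : ¬ IsInvertible U) (hVinv : ¬ IsInvertible V)
    (hcompl : ∀ g : G, g • U ∼ Uᶜ → (g • U ⊆ Uᶜ ↔ g • V ⊆ Vᶜ))
    (hAB : Corresponding U V A B) (hCD : Corresponding U V C D) (hAC : A ∼ C) :
    A ⊆ C ↔ B ⊆ D := by
  obtain ⟨g, ⟨rfl, rfl⟩ | ⟨rfl, rfl⟩⟩ := hAB <;> obtain ⟨k, ⟨rfl, rfl⟩ | ⟨rfl, rfl⟩⟩ := hCD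
  · rw [smul_subset_smul_iff, smul_subset_smul_iff]
    exact hUV.smul_subset_iff hU hV hAC.inv_mul_smul
  · rw [smul_subset_smul_iff, smul_subset_smul_iff]
    exact hcompl _ hAC.inv_mul_smul
  · have hU' := hAC.symm.inv_mul_smul
    have hV' := ((hUV.symm.smul _).trans hU').trans hUV.compl
    have key (S : Set G) : g • Sᶜ ⊆ k • S ↔ Sᶜ ⊆ (g⁻¹ * k) • S := by
      rw [mul_smul, Set.smul_set_subset_iff_subset_inv_smul_set]
    rw [key, key, compl_subset_smul_iff_not hU hUinv hU', compl_subset_smul_iff_not hV hVinv hV',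
      hcompl _ hU']
  · rw [Set.smul_set_compl, Set.smul_set_compl, Set.smul_set_compl, Set.smul_set_compl,
      Set.compl_subset_compl, Set.compl_subset_compl, smul_subset_smul_iff, smul_subset_smul_iff]
    refine hUV.smul_subset_iff hU hV (NontrivialEquivalent.inv_mul_smul ?_)
    simpa [Set.smul_set_compl] using hAC.symm.compl

theorem exists_mem_signedOrbit_smul_subset_compl_iff (hUV : U ∼ V) (hU : HasNestedOrbit U)
    (hV : HasNestedOrbit V) (hUinv : ¬ IsInvertible U) (hVinv : ¬ IsInvertible V) :
    ∃ A ∈ signedOrbit U, ∃ B ∈ signedOrbit V, A ∼ B ∧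
      ∀ g : G, g • A ∼ Aᶜ → (g • A ⊆ Aᶜ ↔ g • B ⊆ Bᶜ) := by
  by_cases hr : ∃ r : G, U ∼ r • Uᶜ
  · obtain ⟨r, hr⟩ := hr
    obtain ⟨A, hA, hUA, hAr⟩ := hU.exists_isCentral hr
    obtain ⟨B, hB, hVB, hBr⟩ := hV.exists_isCentral (hUV.reflect hr)
    have hAB : A ∼ B := (hUA.symm.trans hUV).trans hVB
    exact ⟨A, hA, B, hB, hAB, fun g => hAr.smul_subset_compl_iff hBr hAB (hUA.reflect hr)
      (hU.of_mem_signedOrbit hA) (hV.of_mem_signedOrbit hB)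
      (fun h => hUinv (h.of_mem_signedOrbit hA)) (fun h => hVinv (h.of_mem_signedOrbit hB))⟩
  · refine ⟨U, self_mem_signedOrbit, V, self_mem_signedOrbit, hUV, fun g hg => absurd ?_ hr⟩
    exact ⟨g, by simpa [Set.smul_set_compl] using hg.symm.compl⟩

theorem exists_isOrderCorrespondence (hUV : U ∼ V) (hU : HasNestedOrbit U)
    (hV : HasNestedOrbit V) (hUinv : ¬ IsInvertible U) (hVinv : ¬ IsInvertible V) :
    ∃ R, IsOrderCorrespondence R (signedOrbit U) (signedOrbit V) := by
  obtain ⟨A, hA, B, hB, hAB, hcompl⟩ :=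
    exists_mem_signedOrbit_smul_subset_compl_iff hUV hU hV hUinv hVinv
  rw [← signedOrbit_eq_of_mem hA, ← signedOrbit_eq_of_mem hB]
  refine ⟨Corresponding A B, ?_, ?_, ?_, ?_, ?_, ?_, ?_, ?_⟩
  · rintro _ _ ⟨g, ⟨rfl, -⟩ | ⟨rfl, -⟩⟩
    exacts [mem_signedOrbit_iff.2 ⟨g, Or.inl rfl⟩, mem_signedOrbit_iff.2 ⟨g, Or.inr rfl⟩]
  · rintro _ _ ⟨g, ⟨-, rfl⟩ | ⟨-, rfl⟩⟩
    exacts [mem_signedOrbit_iff.2 ⟨g, Or.inl rfl⟩, mem_signedOrbit_iff.2 ⟨g, Or.inr rfl⟩]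
  · intro C hC
    obtain ⟨g, rfl | rfl⟩ := mem_signedOrbit_iff.1 hC
    exacts [⟨_, g, Or.inl ⟨rfl, rfl⟩⟩, ⟨_, g, Or.inr ⟨rfl, rfl⟩⟩]
  · intro D hD
    obtain ⟨g, rfl | rfl⟩ := mem_signedOrbit_iff.1 hD
    exacts [⟨_, g, Or.inl ⟨rfl, rfl⟩⟩, ⟨_, g, Or.inr ⟨rfl, rfl⟩⟩]
  · rintro _ _ k ⟨g, ⟨rfl, rfl⟩ | ⟨rfl, rfl⟩⟩
    · exact ⟨k * g, Or.inl ⟨smul_smul k g A, smul_smul k g B⟩⟩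
    · exact ⟨k * g, Or.inr ⟨smul_smul k g Aᶜ, smul_smul k g Bᶜ⟩⟩
  · rintro _ _ ⟨g, ⟨rfl, rfl⟩ | ⟨rfl, rfl⟩⟩
    · exact ⟨g, Or.inr ⟨Set.smul_set_compl.symm, Set.smul_set_compl.symm⟩⟩
    · exact ⟨g, Or.inl (by simp [Set.smul_set_compl])⟩
  · rintro _ _ ⟨g, ⟨rfl, rfl⟩ | ⟨rfl, rfl⟩⟩
    exacts [hAB.smul g, hAB.compl.smul g]
  · exact Corresponding.subset_iff hAB (hU.of_mem_signedOrbit hA) (hV.of_mem_signedOrbit hB)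
      (fun h => hUinv (h.of_mem_signedOrbit hA)) (fun h => hVinv (h.of_mem_signedOrbit hB)) hcompl

end Correspondence

namespace IsOrderCorrespondence

variable {R : Set G → Set G → Prop} {𝒜 ℬ : Set (Set G)} {A B C D : Set G}

theorem right_unique (hR : IsOrderCorrespondence R 𝒜 ℬ) (hAB : R A B) (hAD : R A D) : B = D :=
  have hA := (hR.nontrivialEquivalent hAB).left.refl
  ((hR.subset_iff hAB hAD hA).1 subset_rfl).antisymm ((hR.subset_iff hAD hAB hA).1 subset_rfl)

theorem left_unique (hR : IsOrderCorrespondence R 𝒜 ℬ) (hAB : R A B) (hCB : R C B) : A = C :=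
  have hAC := (hR.nontrivialEquivalent hAB).trans (hR.nontrivialEquivalent hCB).symm
  ((hR.subset_iff hAB hCB hAC).2 subset_rfl).antisymm
    ((hR.subset_iff hCB hAB hAC.symm).2 subset_rfl)

theorem almostLE_iff (hR : IsOrderCorrespondence R 𝒜 ℬ) (hAB : R A B) (hCD : R C D) :
    AlmostLE A C ↔ AlmostLE B D :=
  almostLE_congr (hR.nontrivialEquivalent hAB) (hR.nontrivialEquivalent hCD)
    (hR.subset_iff hAB hCD)

theorem iUnion {ι : Type*} {R : ι → Set G → Set G → Prop} {𝒜 ℬ : ι → Set (Set G)}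
    (hR : ∀ i, IsOrderCorrespondence (R i) (𝒜 i) (ℬ i))
    (h𝒜 : ∀ {i j A C}, A ∈ 𝒜 i → C ∈ 𝒜 j → A ∼ C → i = j) :
    IsOrderCorrespondence (fun A B => ∃ i, R i A B) (⋃ i, 𝒜 i) (⋃ i, ℬ i) where
  mem_left := fun ⟨i, h⟩ => Set.mem_iUnion.2 ⟨i, (hR i).mem_left h⟩
  mem_right := fun ⟨i, h⟩ => Set.mem_iUnion.2 ⟨i, (hR i).mem_right h⟩
  exists_right hA :=
    let ⟨i, hi⟩ := Set.mem_iUnion.1 hA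
    ((hR i).exists_right hi).imp fun _ h => ⟨i, h⟩
  exists_left hB :=
    let ⟨i, hi⟩ := Set.mem_iUnion.1 hB
    ((hR i).exists_left hi).imp fun _ h => ⟨i, h⟩
  smul := fun g ⟨i, h⟩ => ⟨i, (hR i).smul g h⟩
  compl := fun ⟨i, h⟩ => ⟨i, (hR i).compl h⟩
  nontrivialEquivalent := fun ⟨i, h⟩ => (hR i).nontrivialEquivalent h
  subset_iff := by
    rintro A B C D ⟨i, hAB⟩ ⟨j, hCD⟩ hAC
    obtain rfl := h𝒜 ((hR i).mem_left hAB) ((hR j).mem_left hCD) hAC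
    exact (hR i).subset_iff hAB hCD hAC

end IsOrderCorrespondence

/-- An isomorphism from `E(Y)` to `E(Z)`: a bijection compatible with the action of `G`, with
complementation, with almost inclusion, and with equivalence classes. -/
structure TranslatesIso {ι κ : Type*} (Y : ι → Set G) (Z : κ → Set G) where
  /-- the underlying bijection -/
  toEquiv : translates Y ≃ translates Z
  map_smul : ∀ (g : G) (A : translates Y), toEquiv (g • A) = g • toEquiv A
  map_star : ∀ A : translates Y, toEquiv (star A) = star (toEquiv A)
  almostLE_iff : ∀ A B : translates Y, AlmostLE A.1 B.1 ↔ AlmostLE (toEquiv A).1 (toEquiv B).1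
  nontrivialEquivalent : ∀ A : translates Y, A.1 ∼ (toEquiv A).1

section TranslatesIso

variable {ι κ : Type*} {Y : ι → Set G} {Z : κ → Set G} {R : Set G → Set G → Prop}

theorem IsOrderCorrespondence.nonempty_translatesIso
    (hR : IsOrderCorrespondence R (translates Y) (translates Z)) :
    Nonempty (TranslatesIso Y Z) := by
  have hex (A : translates Y) : ∃ B : translates Z, R A.1 B.1 :=
    let ⟨B, hB⟩ := hR.exists_right A.2
    ⟨⟨B, hR.mem_right hB⟩, hB⟩
  choose f hf using hex
  have f_eq {A : translates Y} {B : translates Z} (h : R A.1 B.1) : f A = B :=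
    Subtype.ext (hR.right_unique (hf A) h)
  have hinj : f.Injective := fun A B hAB => Subtype.ext (hR.left_unique (hf A) (hAB ▸ hf B))
  have hsurj : f.Surjective := fun B =>
    let ⟨A, hA⟩ := hR.exists_left B.2
    ⟨⟨A, hR.mem_left hA⟩, f_eq hA⟩
  exact ⟨{
    toEquiv := Equiv.ofBijective f ⟨hinj, hsurj⟩
    map_smul := fun g A => f_eq (hR.smul g (hf A))
    map_star := fun A => f_eq (hR.compl (hf A))
    almostLE_iff := fun A B => hR.almostLE_iff (hf A) (hf B)
    nontrivialEquivalent := fun A => hR.nontrivialEquivalent (hf A) }⟩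

namespace TranslatesIso

/-- The inverse isomorphism. -/
def symm (φ : TranslatesIso Y Z) : TranslatesIso Z Y where
  toEquiv := φ.toEquiv.symm
  map_smul g A := by rw [Equiv.symm_apply_eq, φ.map_smul, Equiv.apply_symm_apply]
  map_star A := by rw [Equiv.symm_apply_eq, φ.map_star, Equiv.apply_symm_apply]
  almostLE_iff A B := by rw [φ.almostLE_iff, Equiv.apply_symm_apply, Equiv.apply_symm_apply]
  nontrivialEquivalent A := by
    simpa only [Equiv.apply_symm_apply] using (φ.nontrivialEquivalent (φ.toEquiv.symm A)).symm

theorem finite_orbit_not_mem_iff (φ : TranslatesIso Y Z) (B : translates Y) (x : G) :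
    {A : translates Y | (∃ g : G, A = g • B) ∧ ¬ (x ∈ A.1 ↔ x ∈ (φ.toEquiv A).1)}.Finite := by
  have hB := φ.nontrivialEquivalent B
  obtain ⟨H, hH⟩ := hB.left
  have hfin := finite_smul_of_isFiniteOver hH.1.le_stabilizer (hB.almostEqualOver hH) x
  refine (hfin.preimage Subtype.val_injective.injOn).subset ?_
  rintro _ ⟨⟨g, rfl⟩, hx⟩
  refine ⟨g, rfl, ?_⟩
  have hxB : x ∈ (g • B).1 ↔ g⁻¹ * x ∈ B.1 := Set.mem_smul_set_iff_inv_smul_mem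
  have hxφ : x ∈ (g • φ.toEquiv B).1 ↔ g⁻¹ * x ∈ (φ.toEquiv B).1 :=
    Set.mem_smul_set_iff_inv_smul_mem
  rw [φ.map_smul, hxB, hxφ] at hx
  rw [Set.mem_symmDiff]
  tauto

theorem finite_not_mem_iff [Finite ι] (φ : TranslatesIso Y Z) (x : G) :
    {A : translates Y | ¬ (x ∈ A.1 ↔ x ∈ (φ.toEquiv A).1)}.Finite := by
  have hmem (i : ι) : Y i ∈ translates Y := ⟨1, i, Or.inl (one_smul G _).symm⟩
  refine (Set.finite_iUnion fun i => (φ.finite_orbit_not_mem_iff ⟨Y i, hmem i⟩ x).union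
    (φ.finite_orbit_not_mem_iff (star ⟨Y i, hmem i⟩) x)).subset ?_
  rintro ⟨A, g, i, rfl | rfl⟩ hx
  exacts [Set.mem_iUnion.2 ⟨i, Or.inl ⟨⟨g, rfl⟩, hx⟩⟩, Set.mem_iUnion.2 ⟨i, Or.inr ⟨⟨g, rfl⟩, hx⟩⟩]

/-- The map that an isomorphism from `E(Y)` to `E(Z)` induces on ultrafilters. -/
def mapUltrafilter (φ : TranslatesIso Y Z) (V : UltrafilterOn Y) : UltrafilterOn Z where
  carrier := φ.toEquiv '' V.carrier
  mem_or A := by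
    rw [Set.mem_image_equiv, Set.mem_image_equiv, show φ.toEquiv.symm (star A) = _ from
      φ.symm.map_star A]
    exact V.mem_or _
  not_both A := by
    rw [Set.mem_image_equiv, Set.mem_image_equiv, show φ.toEquiv.symm (star A) = _ from
      φ.symm.map_star A]
    exact V.not_both _
  upward A hA B hAB := by
    rw [Set.mem_image_equiv] at hA ⊢
    exact V.upward _ hA _ ((φ.symm.almostLE_iff A B).1 hAB)

theorem mapUltrafilter_smul (φ : TranslatesIso Y Z) (g : G) (V : UltrafilterOn Y) :
    φ.mapUltrafilter (g • V) = g • φ.mapUltrafilter V :=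
  UltrafilterOn.ext (Set.image_smul_comm _ _ _ (φ.map_smul g))

theorem adj_mapUltrafilter (φ : TranslatesIso Y Z) {V W : UltrafilterOn Y}
    (h : (skeleton Y).Adj V W) :
    (skeleton Z).Adj (φ.mapUltrafilter V) (φ.mapUltrafilter W) := by
  obtain ⟨A, hA, hW⟩ := h
  refine ⟨φ.toEquiv A, Set.mem_image_of_mem _ hA, ?_⟩
  change φ.toEquiv '' W.carrier = φ.toEquiv '' V.carrier \ {φ.toEquiv A} ∪ {star (φ.toEquiv A)}
  rw [hW, Set.image_union, Set.image_sdiff φ.toEquiv.injective, Set.image_singleton,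
    Set.image_singleton, φ.map_star]

theorem isBasic_mapUltrafilter [Finite ι] (φ : TranslatesIso Y Z) {W : UltrafilterOn Y}
    (h : IsBasic W) : IsBasic (φ.mapUltrafilter W) := by
  obtain ⟨g, hg⟩ := h
  refine ⟨g, ((hg.union (φ.finite_not_mem_iff g)).image φ.toEquiv).subset fun B hB => ?_⟩
  obtain ⟨A, rfl⟩ := φ.toEquiv.surjective B
  have hA : φ.toEquiv A ∈ (φ.mapUltrafilter W).carrier ↔ A ∈ W.carrier :=
    φ.toEquiv.injective.mem_set_image
  simp only [Set.mem_union, φ.toEquiv.injective.mem_set_image, Set.mem_symmDiff,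
    Set.mem_ofPred_eq, hA] at hB ⊢
  tauto

/-- The map that an isomorphism from `E(Y)` to `E(Z)` induces on the vertices of the cubings. -/
def mapVertex [Finite ι] (φ : TranslatesIso Y Z) (V : LVertex Y) : LVertex Z :=
  ⟨φ.mapUltrafilter V.1,
    let ⟨W, hW, hWV⟩ := V.2
    let f : skeleton Y →g skeleton Z := ⟨φ.mapUltrafilter, φ.adj_mapUltrafilter⟩
    ⟨φ.mapUltrafilter W, φ.isBasic_mapUltrafilter hW, hWV.map f⟩⟩

variable [Finite ι] [Finite κ]

/-- The bijection that an isomorphism from `E(Y)` to `E(Z)` induces between the vertices of the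
cubings. -/
def vertexEquiv (φ : TranslatesIso Y Z) : LVertex Y ≃ LVertex Z where
  toFun := φ.mapVertex
  invFun := φ.symm.mapVertex
  left_inv V := Subtype.ext (UltrafilterOn.ext (φ.toEquiv.symm_image_image V.1.carrier))
  right_inv V := Subtype.ext (UltrafilterOn.ext (φ.toEquiv.image_symm_image V.1.carrier))

theorem isCube_image_vertexEquiv (φ : TranslatesIso Y Z) {d : ℕ} {S : Set (LVertex Y)}
    (h : IsCube Y d S) : IsCube Z d (φ.vertexEquiv '' S) := by
  obtain ⟨f, hf, rfl, hadj⟩ := h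
  exact ⟨φ.vertexEquiv ∘ f, φ.vertexEquiv.injective.comp hf, Set.range_comp _ _,
    fun a b hab => φ.adj_mapUltrafilter (hadj a b hab)⟩

theorem isCube_iff_isCube_image (φ : TranslatesIso Y Z) (d : ℕ) (S : Set (LVertex Y)) :
    IsCube Y d S ↔ IsCube Z d (φ.vertexEquiv '' S) := by
  refine ⟨φ.isCube_image_vertexEquiv, fun h => ?_⟩
  have hS : φ.symm.vertexEquiv '' (φ.vertexEquiv '' S) = S := φ.vertexEquiv.symm_image_image S
  exact hS ▸ φ.symm.isCube_image_vertexEquiv h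

end TranslatesIso

end TranslatesIso

theorem orbitsParallel_of_equivalent_of_mem_signedOrbit {U V U' V' A B : Set G}
    (hU : U ∼ U') (hV : V ∼ V') (hA : A ∈ signedOrbit U') (hB : B ∈ signedOrbit V')
    (hAB : A ∼ B) : OrbitsParallel U V := by
  obtain ⟨C, hC, hAC⟩ := exists_mem_signedOrbit_nontrivialEquivalent hU.symm hA
  obtain ⟨D, hD, hBD⟩ := exists_mem_signedOrbit_nontrivialEquivalent hV.symm hB
  exact orbitsParallel_of_mem_signedOrbit hC hD ((hAC.symm.trans hAB).trans hBD)

theorem nonempty_translatesIso {ι : Type*} {X Y Z : ι → Set G}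
    (hpar : ∀ i j, i ≠ j → ¬ OrbitsParallel (X i) (X j))
    (hXY : ∀ i, X i ∼ Y i) (hXZ : ∀ i, X i ∼ Z i) (hY : GoodPosition Y) (hZ : GoodPosition Z)
    (hYinv : ∀ i, ¬ IsInvertible (Y i)) (hZinv : ∀ i, ¬ IsInvertible (Z i)) :
    Nonempty (TranslatesIso Y Z) := by
  choose R hR using fun i => exists_isOrderCorrespondence ((hXY i).symm.trans (hXZ i))
    (hY.hasNestedOrbit i) (hZ.hasNestedOrbit i) (hYinv i) (hZinv i)
  have hunion := IsOrderCorrespondence.iUnion hR fun {i j} _ _ hA hC hAC =>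
    not_imp_not.1 (hpar i j)
      (orbitsParallel_of_equivalent_of_mem_signedOrbit (hXY i) (hXY j) hA hC hAC)
  rw [← translates_eq_iUnion, ← translates_eq_iUnion] at hunion
  exact hunion.nonempty_translatesIso

end AlmostInvariant

open AlmostInvariant in
theorem mainTheorem5_general {G : Type*} [Group G] {ι : Type*} [Finite ι]
    (H : ι → Subgroup G) (X Y Z : ι → Set G)
    (hX : ∀ i, IsNontrivialAlmostInvariant (H i) (X i))
    (hpar : ∀ i j, i ≠ j → ¬ OrbitsParallel (X i) (X j))
    (hXY : ∀ i, Equivalent (X i) (Y i)) (hXZ : ∀ i, Equivalent (X i) (Z i))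
    (hY : GoodPosition Y) (hZ : GoodPosition Z)
    (hYinv : ∀ i, ¬ IsInvertible (Y i)) (hZinv : ∀ i, ¬ IsInvertible (Z i)) :
    ∃ φ : translates Y ≃ translates Z,
      (∀ (g : G) (A : translates Y), φ (g • A) = g • φ A) ∧
      (∀ A : translates Y, φ (star A) = star (φ A)) ∧
      (∀ A B : translates Y, AlmostLE A.1 B.1 ↔ AlmostLE (φ A).1 (φ B).1) ∧
      (∀ A : translates Y, Equivalent A.1 (φ A).1) ∧
      ∃ ψ : LVertex Y ≃ LVertex Z,
        (∀ V : LVertex Y, (ψ V).1.carrier = φ '' V.1.carrier) ∧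
        (∀ (g : G) (V : LVertex Y), ψ (g • V) = g • ψ V) ∧
        ∀ (d : ℕ) (S : Set (LVertex Y)), IsCube Y d S ↔ IsCube Z d (ψ '' S) := by
  obtain ⟨φ⟩ := nonempty_translatesIso hpar (fun i => (hX i).nontrivialEquivalent (hXY i))
    (fun i => (hX i).nontrivialEquivalent (hXZ i)) hY hZ hYinv hZinv
  exact ⟨φ.toEquiv, φ.map_smul, φ.map_star, φ.almostLE_iff,
    fun A => (φ.nontrivialEquivalent A).equivalent, φ.vertexEquiv, fun V => rfl,
    fun g V => Subtype.ext (φ.mapUltrafilter_smul g V.1), φ.isCube_iff_isCube_image⟩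

open AlmostInvariant in
theorem mainTheorem5 {G : Type*} [Group G] [Group.FG G] (n : ℕ)
    (H : Fin n → Subgroup G) (hH : ∀ i, (H i).FG)
    (X Y Z : Fin n → Set G)
    (hX : ∀ i, IsNontrivialAlmostInvariant (H i) (X i))
    (hpar : ∀ i j, i ≠ j → ¬ OrbitsParallel (X i) (X j))
    (hXY : ∀ i, Equivalent (X i) (Y i)) (hXZ : ∀ i, Equivalent (X i) (Z i))
    (hY : GoodPosition Y) (hZ : GoodPosition Z)
    (hYinv : ∀ i, ¬ IsInvertible (Y i)) (hZinv : ∀ i, ¬ IsInvertible (Z i)) :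
    ∃ φ : translates Y ≃ translates Z,
      (∀ (g : G) (A : translates Y), φ (g • A) = g • φ A) ∧
      (∀ A : translates Y, φ (star A) = star (φ A)) ∧
      (∀ A B : translates Y, AlmostLE A.1 B.1 ↔ AlmostLE (φ A).1 (φ B).1) ∧
      (∀ A : translates Y, Equivalent A.1 (φ A).1) ∧
      ∃ ψ : LVertex Y ≃ LVertex Z,
        (∀ V : LVertex Y, (ψ V).1.carrier = φ '' V.1.carrier) ∧
        (∀ (g : G) (V : LVertex Y), ψ (g • V) = g • ψ V) ∧
        ∀ (d : ℕ) (S : Set (LVertex Y)), IsCube Y d S ↔ IsCube Z d (ψ '' S) :=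
  mainTheorem5_general H X Y Z hX hpar hXY hXZ hY hZ hYinv hZinv
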